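/- Let $K$ be a field and let $I \subseteq K[x,y]$ be a zero-dimensional ideal of degree $D$, i.e. $K[x,y]/I$ has finite dimension $D$ as a $K$-vector space. Use the degree reverse lexicographic order with $x \prec y$: $x^a y^b \prec x^{a'} y^{b'}$ if and only if $a+b < a'+b'$, or $a+b=a'+b'$ and $a > a'$; write $\operatorname{lm}(f)$ for the leading monomial of $f$ for this order, and $\deg_y$ for the degree in $y$. Let $(g_0,\dots,g_{\ell-1})$ be a minimal Gröbner basis of $I$ for this order (no leading term of an element lies in the ideal generated by the leading terms of the others), sorted by increasing $\deg_y(\operatorname{lm}(g_i))$. Define $$n_i = \deg_y(\operatorname{lm}(g_{i+1})) - \deg_y(\operatorname{lm}(g_i)) \quad (0 \le i < \ell-1),$$ $$n_{\ell-1} = \max\Bigl(1,\ \max_{0 \le i \le \ell-2}\bigl(n_i + \deg_y(g_i)\bigr) - \deg_y(g_{\ell-1})\Bigr)$$ (with $n_{0}=1$ when $\ell=1$, which happens only for $I=K[x,y]$), and $n = n_0+\dots+n_{\ell-1}$. Let $M \in K[x]^{n\times n}$ be the matrix whose $r$-th row consists of the coordinates on $(1,y,\dots,y^{n-1})$ of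 the $r$-th polynomial of the tuple $$(g_0, y g_0, \dots, y^{n_0-1} g_0,\ \dots,\ g_{\ell-1}, \dots, y^{n_{\ell-1}-1} g_{\ell-1}),$$ viewed in $K[x][y]$. Then all polynomials of this tuple belong to $I_{<(\cdot,n)} = \{f \in I : \deg_y f < n\}$, so that the rows of $M$ represent them, and $M$ is formed by stacked Toeplitz blocks: for $0\le i<\ell$, $0 \le k < n_i$ and $0\le c<n$, the entry of $M$ in row $n_0+\dots+n_{i-1}+k$ and column $c$ is the coefficient in $K[x]$ of $y^{c-k}$ in $g_i$ if $c \ge k$, and $0$ otherwise. Moreover: 1. $M$ is in $s$-weak Popov form for the shift $s=(0,1,\dots,n-1)$. That is, with $t_i = \max_{0\le j<n}(\deg(M_{i,j}) + s_j)$, the $s$-leading matrix of $M$, whose entry $(i,j)$ is the coefficient of degree $t_i - s_j$ of $M_{i,j}$ (or $0$ if $t_i=-\infty$), is invertible and lower triangular. 2. $\deg(\det M) = D$. 3. $M$ is a basis of the $K[x]$-module $I_{<(\cdot,n)}$, seen as a submodule of $K[x]^{1\times n}$ through the coordinates on $(1,y,\dots,y^{n-1})$: $\det M \neq 0$ and the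 $K[x]$-row span of $M$ is $I_{<(\cdot,n)}$. -/

import Mathlib

open Polynomial
open scoped Polynomial.Bivariate

noncomputable section

/-! ## The degree reverse lexicographic order on monomials in two variables

A monomial `x ^ a * y ^ b` is represented by the exponent `c : Fin 2 →₀ ℕ` with `c 0 = a` and
`c 1 = b`, so that the variable of index `0` is `x` and the variable of index `1` is `y`. -/

/-- Exponents of monomials in `x, y`, to be ordered by the degree reverse lexicographic order. -/
structure DegRevLex₂ where
  /-- The underlying exponent. -/
  exp : Fin 2 →₀ ℕ

namespace DegRevLex₂

/-- The identification of `DegRevLex₂` with the exponents. -/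
def equiv : DegRevLex₂ ≃ (Fin 2 →₀ ℕ) where
  toFun := exp
  invFun := mk

instance : AddCommMonoid DegRevLex₂ := equiv.addCommMonoid

theorem exp_add (a b : DegRevLex₂) : (a + b).exp = a.exp + b.exp := rfl

/-- Exponents are compared by total degree first; ties are broken in favour of the monomial with
the smaller exponent of `x`, which is the smallest variable. -/
def key (a : DegRevLex₂) : ℕ ×ₗ ℕᵒᵈ := toLex (a.exp 0 + a.exp 1, OrderDual.toDual (a.exp 0))

theorem key_injective : Function.Injective key := by
  rintro ⟨a⟩ ⟨b⟩ h
  have h1 : a 0 + a 1 = b 0 + b 1 := congrArg (fun p => (ofLex p).1) h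
  have h2 : a 0 = b 0 := congrArg (fun p => OrderDual.ofDual (ofLex p).2) h
  congr 1
  ext i
  fin_cases i
  · exact h2
  · change a 1 = b 1
    omega

instance : LinearOrder DegRevLex₂ := LinearOrder.lift' key key_injective

theorem lt_iff (a b : DegRevLex₂) :
    a < b ↔ a.exp 0 + a.exp 1 < b.exp 0 + b.exp 1 ∨
      (a.exp 0 + a.exp 1 = b.exp 0 + b.exp 1 ∧ b.exp 0 < a.exp 0) := by
  change key a < key b ↔ _
  simp [key, Prod.Lex.toLex_lt_toLex]

theorem le_iff (a b : DegRevLex₂) :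
    a ≤ b ↔ a.exp 0 + a.exp 1 < b.exp 0 + b.exp 1 ∨
      (a.exp 0 + a.exp 1 = b.exp 0 + b.exp 1 ∧ b.exp 0 ≤ a.exp 0) := by
  change key a ≤ key b ↔ _
  simp [key, Prod.Lex.toLex_le_toLex]

instance : IsOrderedAddMonoid DegRevLex₂ where
  add_le_add_left a b h c := by
    rw [le_iff] at h ⊢
    simp only [exp_add, Finsupp.add_apply]
    omega

instance : WellFoundedLT DegRevLex₂ where
  wf := by
    refine Subrelation.wf (r := InvImage (· < ·)
      fun a : DegRevLex₂ => (toLex (a.exp 0 + a.exp 1, a.exp 1) : ℕ ×ₗ ℕ)) ?_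
      (InvImage.wf _ wellFounded_lt)
    intro a b h
    rw [lt_iff] at h
    change toLex (a.exp 0 + a.exp 1, a.exp 1) < toLex (b.exp 0 + b.exp 1, b.exp 1)
    rw [Prod.Lex.toLex_lt_toLex]
    dsimp only
    omega

end DegRevLex₂

/-- The degree reverse lexicographic order in two variables, with `x` smaller than `y`. -/
def drl : MonomialOrder (Fin 2) where
  syn := DegRevLex₂
  toSyn := { toEquiv := DegRevLex₂.equiv.symm, map_add' := fun _ _ => rfl }
  toSyn_monotone a b h := by
    rw [DegRevLex₂.le_iff]
    have h0 := h 0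
    have h1 := h 1
    change a 0 + a 1 < b 0 + b 1 ∨ (a 0 + a 1 = b 0 + b 1 ∧ b 0 ≤ a 0)
    omega

/-- `x ^ a * y ^ b` is smaller than `x ^ a' * y ^ b'` iff its total degree is smaller, or the total
degrees agree and `a' < a`. -/
theorem drl_lt_iff (c d : Fin 2 →₀ ℕ) :
    drl.toSyn c < drl.toSyn d ↔
      c 0 + c 1 < d 0 + d 1 ∨ (c 0 + c 1 = d 0 + d 1 ∧ d 0 < c 0) :=
  DegRevLex₂.lt_iff ⟨c⟩ ⟨d⟩

/-! ## Gröbner bases -/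

/-- A finite family `g` of elements of the ideal `J` is a Gröbner basis of `J` for the monomial
order `m` if the leading terms of the `g i` generate the ideal of leading terms of `J`. -/
def IsGroebnerBasis {σ ι K : Type*} [Field K] [Finite ι] (m : MonomialOrder σ)
    (J : Ideal (MvPolynomial σ K)) (g : ι → MvPolynomial σ K) : Prop :=
  (∀ i, g i ∈ J) ∧
    Ideal.span (Set.range fun i => m.leadingTerm (g i)) =
      Ideal.span (m.leadingTerm '' (J : Set (MvPolynomial σ K)))

/-- A Gröbner basis is minimal if no leading term of one of its elements is in the ideal generated
by the leading terms of the others. -/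
def IsMinimalGroebnerBasis {σ ι K : Type*} [Field K] [Finite ι] (m : MonomialOrder σ)
    (J : Ideal (MvPolynomial σ K)) (g : ι → MvPolynomial σ K) : Prop :=
  IsGroebnerBasis m J g ∧
    ∀ i, m.leadingTerm (g i) ∉ Ideal.span ((fun j => m.leadingTerm (g j)) '' {j | j ≠ i})

/-! ## Shifted forms of univariate polynomial matrices -/

section Shifted

variable {K : Type*} [Field K] {n : ℕ}

/-- The `i`-th entry of the `s`-row degree of `M`, the maximum of `deg (M i j) + s j` over `j`. -/
def shiftedRowDegree (s : Fin n → ℤ) (M : Matrix (Fin n) (Fin n) K[X]) (i : Fin n) : WithBot ℤ :=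
  Finset.univ.sup fun j => (M i j).degree.map (fun d : ℕ => (d : ℤ)) + (s j : WithBot ℤ)

/-- The `s`-leading matrix of `M`: with `t` the `i`-th entry of the `s`-row degree, its entry
`(i, j)` is the coefficient of degree `t - s j` of `M i j`; it is `0` if the row is zero. -/
def shiftedLeadingMatrix (s : Fin n → ℤ) (M : Matrix (Fin n) (Fin n) K[X]) :
    Matrix (Fin n) (Fin n) K :=
  Matrix.of fun i j =>
    WithBot.recBotCoe (C := fun _ => K) 0
      (fun t : ℤ => if 0 ≤ t - s j then (M i j).coeff (t - s j).toNat else 0)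
      (shiftedRowDegree s M i)

/-- `M` is in `s`-weak Popov form if its `s`-leading matrix is invertible and lower triangular. -/
def IsShiftedWeakPopov (s : Fin n → ℤ) (M : Matrix (Fin n) (Fin n) K[X]) : Prop :=
  IsUnit (shiftedLeadingMatrix s M) ∧ (shiftedLeadingMatrix s M).IsLowerTriangular

/-- `M` is a basis of the submodule `N` of the row vectors `K[x]^n` if it is nonsingular and its
row span is `N`. -/
def IsBasisMatrix (M : Matrix (Fin n) (Fin n) K[X]) (N : Submodule K[X] (Fin n → K[X])) : Prop :=
  M.det ≠ 0 ∧ Submodule.span K[X] (Set.range fun i => M i) = N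

end Shifted

/-! ## The matrix built from a Gröbner basis

In `K[X][Y]` the inner variable is `x`, the outer one is `y`; thus `natDegree` is the degree in `y`
and `coeff j` is the coefficient in `K[x]` of `y ^ j`. -/

section Bivariate

variable {K : Type*} [Field K]

/-- The exponent of the leading monomial of `f` for the degree reverse lexicographic order. -/
def lmExp (f : K[X][Y]) : Fin 2 →₀ ℕ :=
  drl.degree (Bivariate.equivMvPolynomial K f)

/-- The degree in `y` of the leading monomial of `f`. -/
def lmYDegree (f : K[X][Y]) : ℕ := lmExp f 1

/-- `g` is a minimal Gröbner basis of `I` for the degree reverse lexicographic order. -/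
def IsMinimalDrlBasis {ι : Type*} [Finite ι] (I : Ideal K[X][Y]) (g : ι → K[X][Y]) : Prop :=
  IsMinimalGroebnerBasis drl (I.map (Bivariate.equivMvPolynomial K))
    fun i => Bivariate.equivMvPolynomial K (g i)

/-- `n_i` for an index `i` that is not the last one. -/
def innerBlockSize {l : ℕ} (g : Fin (l + 1) → K[X][Y]) (i : Fin l) : ℕ :=
  lmYDegree (g i.succ) - lmYDegree (g i.castSucc)

/-- `n_i` for the last index `i = l`. -/
def lastBlockSize {l : ℕ} (g : Fin (l + 1) → K[X][Y]) : ℕ :=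
  max 1 ((Finset.univ.sup fun i : Fin l => innerBlockSize g i + (g i.castSucc).natDegree)
    - (g (Fin.last l)).natDegree)

/-- The tuple `(n_0, …, n_l)`. -/
def blockSize {l : ℕ} (g : Fin (l + 1) → K[X][Y]) : Fin (l + 1) → ℕ :=
  Fin.snoc (α := fun _ => ℕ) (innerBlockSize g) (lastBlockSize g)

/-- `n = n_0 + ⋯ + n_l`. -/
def matrixSize {l : ℕ} (g : Fin (l + 1) → K[X][Y]) : ℕ := ∑ i, blockSize g i

/-- The position `n_0 + ⋯ + n_{i-1} + k` of the `k`-th row of the `i`-th block. -/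
def rowIndex {l : ℕ} (g : Fin (l + 1) → K[X][Y]) :
    (Σ i : Fin (l + 1), Fin (blockSize g i)) ≃ Fin (matrixSize g) :=
  finSigmaFinEquiv

/-- The tuple `(g_0, y g_0, …, y^(n_0 - 1) g_0, …, g_l, …, y^(n_l - 1) g_l)`. -/
def shiftedFamily {l : ℕ} (g : Fin (l + 1) → K[X][Y]) (r : Fin (matrixSize g)) : K[X][Y] :=
  X ^ (((rowIndex g).symm r).2 : ℕ) * g ((rowIndex g).symm r).1

/-- The coordinates on `1, y, …, y^(n - 1)`. -/
def yCoords (K : Type*) [Field K] (n : ℕ) : K[X][Y] →ₗ[K[X]] (Fin n → K[X]) :=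
  LinearMap.pi fun j => lcoeff K[X] (j : ℕ)

/-- The matrix whose `r`-th row consists of the coordinates on `1, y, …, y^(n - 1)` of the `r`-th
polynomial of the tuple `shiftedFamily g`. -/
def blockMatrix {l : ℕ} (g : Fin (l + 1) → K[X][Y]) :
    Matrix (Fin (matrixSize g)) (Fin (matrixSize g)) K[X] :=
  Matrix.of fun r => yCoords K (matrixSize g) (shiftedFamily g r)

/-- The `K[x]`-module of the elements of `I` of degree in `y` less than `n`. -/
def truncatedIdeal (I : Ideal K[X][Y]) (n : ℕ) : Submodule K[X] K[X][Y] :=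
  Submodule.restrictScalars K[X] I ⊓ degreeLT K[X] n

end Bivariate

end

/-! ### Leading monomials for the degree reverse lexicographic order -/

section Lead

variable {K : Type*} [Field K]

/-! Everything follows from one fact: row `r` of the matrix has leading monomial `x ^ α r * y ^ r`,
where `α b` is the least `x`-exponent among the leading monomials in `I` of `y`-degree `b`. Finite
dimension puts a nonzero polynomial in `x` alone and one in `y` alone into `I`, so the staircase
starts at `y`-degree `0` and ends on a pure power of `y`. The block sizes then telescope to the row
positions (`rowIndex_val`), and minimality makes the `x`-exponents strictly decrease along `g`
(`lmExp_le_of_hasLead`). Division by the rows, using only powers of `x` as multipliers, shows that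
they span the truncated ideal. The monomials `x ^ a * y ^ b` with `a < α b` form a basis of the
quotient, so `D = ∑ α r`. For the shift `(0, 1, …)` the shifted degree of an entry is a total
degree, and the tie-break in favour of `y` makes the leading matrix lower triangular with nonzero
diagonal; this also forces `deg (det M) = ∑ α r`. -/

theorem coeff_equivMvPolynomial (f : K[X][Y]) (e : Fin 2 →₀ ℕ) :
    (Bivariate.equivMvPolynomial K f).coeff e = (f.coeff (e 1)).coeff (e 0) := by
  induction f using Polynomial.induction_on' with
  | add p q hp hq => simp [hp, hq]
  | monomial b p =>
    induction p using Polynomial.induction_on' with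
    | add p q hp hq => simp only [map_add, MvPolynomial.coeff_add, hp, hq, coeff_add]
    | monomial a c =>
      have h : Bivariate.equivMvPolynomial K (monomial b (monomial a c)) =
          MvPolynomial.monomial (Finsupp.single 0 a + Finsupp.single 1 b) c := by
        rw [← C_mul_X_pow_eq_monomial, ← C_mul_X_pow_eq_monomial, MvPolynomial.monomial_eq]
        simp only [map_mul, map_pow, Bivariate.equivMvPolynomial_C_C,
          Bivariate.equivMvPolynomial_C_X, Bivariate.equivMvPolynomial_X]
        rw [Finsupp.prod_fintype _ _ (by simp)]
        simp [mul_assoc]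
      rw [h, MvPolynomial.coeff_monomial, coeff_monomial]
      have he : Finsupp.single 0 a + Finsupp.single 1 b = e ↔ b = e 1 ∧ a = e 0 := by
        rw [Finsupp.ext_iff]
        simp [Fin.forall_fin_two, and_comm]
      rw [if_congr he rfl rfl]
      by_cases hb : b = e 1 <;> by_cases ha : a = e 0 <;> simp [ha, hb, coeff_monomial]

/-- `x ^ a * y ^ b` is larger than all the monomials of `f`. -/
def IsBelow (f : K[X][Y]) (a b : ℕ) : Prop :=
  ∀ a' b', (f.coeff b').coeff a' ≠ 0 → a' + b' < a + b ∨ (a' + b' = a + b ∧ a < a')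

/-- `x ^ a * y ^ b` is the leading monomial of `f` for the degree reverse lexicographic order. -/
def HasLead (f : K[X][Y]) (a b : ℕ) : Prop :=
  (f.coeff b).coeff a ≠ 0 ∧
    ∀ a' b', (f.coeff b').coeff a' ≠ 0 → a' + b' < a + b ∨ (a' + b' = a + b ∧ a ≤ a')

theorem hasLead_lmExp {f : K[X][Y]} (hf : f ≠ 0) : HasLead f (lmExp f 0) (lmExp f 1) := by
  refine ⟨?_, fun a b h => ?_⟩
  · rw [← coeff_equivMvPolynomial, lmExp, MonomialOrder.coeff_degree_ne_zero_iff]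
    simpa using hf
  · let e : Fin 2 →₀ ℕ := Finsupp.single 0 a + Finsupp.single 1 b
    have e0 : e 0 = a := by simp [e]
    have e1 : e 1 = b := by simp [e]
    have hm : e ∈ (Bivariate.equivMvPolynomial K f).support := by
      rw [MvPolynomial.mem_support_iff, coeff_equivMvPolynomial, e0, e1]
      exact h
    have := (drl.le_degree hm).lt_or_eq
    rw [drl_lt_iff, e0, e1] at this
    rcases this with h | h
    · change _ ∨ _ ∧ lmExp f 0 < a at h
      change _ < lmExp f 0 + lmExp f 1 ∨ _ = lmExp f 0 + lmExp f 1 ∧ _ at h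
      omega
    · have h : e = lmExp f := drl.toSyn.injective h
      rw [← h, e0, e1]
      omega

theorem HasLead.ne_zero {f : K[X][Y]} {a b : ℕ} (h : HasLead f a b) : f ≠ 0 := by
  rintro rfl
  exact h.1 (by simp)

theorem HasLead.unique {f : K[X][Y]} {a b a' b' : ℕ} (h : HasLead f a b) (h' : HasLead f a' b') :
    a = a' ∧ b = b' := by
  have h1 := h.2 _ _ h'.1
  have h2 := h'.2 _ _ h.1
  omega

theorem exists_hasLead {f : K[X][Y]} (hf : f ≠ 0) : ∃ a b, HasLead f a b :=
  ⟨_, _, hasLead_lmExp hf⟩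

theorem HasLead.of_isBelow {f : K[X][Y]} {a b a' b' : ℕ} (h : IsBelow f a b)
    (h' : HasLead f a' b') : a' + b' < a + b ∨ (a' + b' = a + b ∧ b' < b) := by
  have := h _ _ h'.1
  omega

/-- Induction on the leading monomial. -/
theorem lead_induction {P : K[X][Y] → Prop} (zero : P 0)
    (step : ∀ f a b, HasLead f a b → (∀ g, IsBelow g a b → P g) → P f) (f : K[X][Y]) : P f := by
  -- At fixed total degree, a larger exponent of `x` means a smaller exponent of `y`, so the order
  -- is the well-founded lexicographic order on `(a + b, b)`.
  have key : ∀ t : ℕ ×ₗ ℕ, ∀ f a b, toLex (a + b, b) = t → HasLead f a b → P f := by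
    intro t
    induction t using WellFoundedLT.induction with
    | _ t ih =>
    rintro f a b rfl h
    refine step f a b h fun g hg => ?_
    by_cases g0 : g = 0
    · rwa [g0]
    · obtain ⟨a', b', h'⟩ := exists_hasLead g0
      refine ih _ ?_ g a' b' rfl h'
      rw [Prod.Lex.toLex_lt_toLex]
      exact h'.of_isBelow hg
  by_cases f0 : f = 0
  · rwa [f0]
  · obtain ⟨a, b, h⟩ := exists_hasLead f0
    exact key _ f a b rfl h

theorem HasLead.shift {f : K[X][Y]} {a b : ℕ} (h : HasLead f a b) (i j : ℕ) :
    HasLead (C (X ^ i) * (X ^ j * f)) (a + i) (b + j) := by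
  refine ⟨?_, fun a' b' h' => ?_⟩
  · rw [coeff_C_mul, coeff_X_pow_mul, mul_comm, coeff_mul_X_pow]
    exact h.1
  · rw [coeff_C_mul, coeff_X_pow_mul', mul_comm, coeff_mul_X_pow'] at h'
    split_ifs at h' with h1 h2
    · have := h.2 _ _ h'
      omega
    · simp at h'
    · simp at h'

theorem HasLead.isBelow_sub {f g : K[X][Y]} {a b : ℕ} (hf : HasLead f a b) (hg : HasLead g a b) :
    ∃ c : K, IsBelow (f - C (C c) * g) a b := by
  refine ⟨(f.coeff b).coeff a / (g.coeff b).coeff a, fun a' b' h => ?_⟩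
  rw [coeff_sub, coeff_C_mul, coeff_sub, coeff_C_mul] at h
  have hne : ¬ (a' = a ∧ b' = b) := by
    rintro ⟨rfl, rfl⟩
    exact h (by rw [div_mul_cancel₀ _ hg.1, sub_self])
  have : a' + b' < a + b ∨ (a' + b' = a + b ∧ a ≤ a') := by
    by_cases h0 : (f.coeff b').coeff a' = 0
    · refine hg.2 _ _ fun h1 => h ?_
      rw [h0, h1, mul_zero, sub_zero]
    · exact hf.2 _ _ h0
  omega

theorem hasLead_monomial (a b : ℕ) : HasLead (monomial b (monomial a (1 : K))) a b := by
  refine ⟨by simp, fun a' b' h => ?_⟩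
  by_cases hb : b = b' <;> by_cases ha : a = a' <;> simp_all [coeff_monomial]

end Lead

/-! ### Division and the monomials under the staircase -/

section Division

variable {K : Type*} [Field K]

/-- The leading monomial of `f` has some `y`-degree `b < n`; a power of `x` times `h b` has the same
one, so it can be cancelled without leaving the truncated ideal. No multiplication by `y` is needed,
hence the span over `K[x]`. -/
theorem truncatedIdeal_le_span {n : ℕ} {I : Ideal K[X][Y]} {h : Fin n → K[X][Y]} {α : Fin n → ℕ}
    (hmem : ∀ r, h r ∈ truncatedIdeal I n) (hlead : ∀ r, HasLead (h r) (α r) r)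
    (hI : ∀ f ∈ I, ∀ a (b : Fin n), HasLead f a b → α b ≤ a) :
    truncatedIdeal I n ≤ Submodule.span K[X] (Set.range h) := by
  intro f
  induction f using lead_induction with
  | zero => exact fun _ => zero_mem _
  | step f a b hf ih =>
  intro hfI
  have hb : b < n := by
    by_contra! hb
    refine hf.1 ?_
    rw [Polynomial.mem_degreeLT.1 hfI.2 |> fun hd => coeff_eq_zero_of_degree_lt
      (hd.trans_le (by exact_mod_cast hb)), coeff_zero]
  have hle := hI f hfI.1 a ⟨b, hb⟩ hf
  have hl := (hlead ⟨b, hb⟩).shift (a - α ⟨b, hb⟩) 0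
  rw [Nat.add_sub_of_le hle, pow_zero, one_mul] at hl
  obtain ⟨c, hc⟩ := hf.isBelow_sub hl
  rw [← mul_assoc, ← C_mul, ← smul_eq_C_mul] at hc
  have := ih _ hc (sub_mem hfI (Submodule.smul_mem _ _ (hmem _)))
  exact (Submodule.sub_mem_iff_left _
    (Submodule.smul_mem _ _ (Submodule.subset_span (Set.mem_range_self _)))).1 this

/-- The polynomial with given coefficients on the monomials `x ^ a * y ^ b` with `a < α b`. -/
noncomputable def underStaircase {n : ℕ} (α : Fin n → ℕ) : ((Σ b : Fin n, Fin (α b)) → K) →ₗ[K] K[X][Y] :=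
  Fintype.linearCombination K fun s => monomial (s.1 : ℕ) (monomial (s.2 : ℕ) (1 : K))

theorem coeff_underStaircase {n : ℕ} (α : Fin n → ℕ) (v : (Σ b : Fin n, Fin (α b)) → K)
    (s : Σ b : Fin n, Fin (α b)) :
    ((underStaircase α v).coeff (s.1 : ℕ)).coeff (s.2 : ℕ) = v s := by
  rw [underStaircase, Fintype.linearCombination_apply, finsetSum_coeff, finsetSum_coeff,
    Finset.sum_eq_single s]
  · simp
  · rintro ⟨b, a⟩ - hne
    obtain ⟨b', a'⟩ := s
    by_cases hb : b = b'
    · subst hb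
      have : (a : ℕ) ≠ a' := fun h => hne (by rw [Fin.ext h])
      simp [coeff_monomial, this]
    · have : (b : ℕ) ≠ b' := fun h => hb (Fin.ext h)
      simp [coeff_monomial, this]
  · simp

theorem exists_of_coeff_underStaircase_ne_zero {n : ℕ} {α : Fin n → ℕ}
    {v : (Σ b : Fin n, Fin (α b)) → K} {a b : ℕ}
    (h : ((underStaircase α v).coeff b).coeff a ≠ 0) :
    ∃ s : Σ b : Fin n, Fin (α b), (s.1 : ℕ) = b ∧ (s.2 : ℕ) = a := by
  rw [underStaircase, Fintype.linearCombination_apply, finsetSum_coeff, finsetSum_coeff] at h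
  obtain ⟨s, -, hs⟩ := Finset.exists_ne_zero_of_sum_ne_zero h
  refine ⟨s, ?_⟩
  by_cases hb : (s.1 : ℕ) = b <;> by_cases ha : (s.2 : ℕ) = a <;> simp_all [coeff_monomial]

/-- Macaulay's basis theorem: the `∑ α r` monomials under the staircase form a basis of the
quotient. The row `r₀`, led by a pure power of `y`, reduces all monomials of `y`-degree at least
`n`. -/
theorem finrank_quotient_eq_sum {n : ℕ} {I : Ideal K[X][Y]} {h : Fin n → K[X][Y]} {α : Fin n → ℕ}
    (hmem : ∀ r, h r ∈ I) (hlead : ∀ r, HasLead (h r) (α r) r)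
    (hI : ∀ f ∈ I, ∀ a (b : Fin n), HasLead f a b → α b ≤ a)
    (r₀ : Fin n) (hr₀ : α r₀ = 0) :
    Module.finrank K (K[X][Y] ⧸ I) = ∑ r, α r := by
  let φ := (Ideal.Quotient.mkₐ K I).toLinearMap ∘ₗ underStaircase α
  have hφ : ∀ v, φ v = 0 ↔ underStaircase α v ∈ I := fun v => Ideal.Quotient.eq_zero_iff_mem
  have inj : Function.Injective φ := by
    rw [injective_iff_map_eq_zero]
    intro v hv
    rw [hφ] at hv
    -- A nonzero combination would have its leading monomial under the staircase, which no element
    -- of `I` does.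
    have h0 : underStaircase α v = 0 := by
      by_contra hne
      obtain ⟨a, b, hl⟩ := exists_hasLead hne
      obtain ⟨s, rfl, rfl⟩ := exists_of_coeff_underStaircase_ne_zero hl.1
      exact absurd (hI _ hv _ _ hl) (by simp)
    ext s
    rw [← coeff_underStaircase α v s, h0]
    simp
  have surj : ∀ f : K[X][Y], ∃ v, f - underStaircase α v ∈ I := by
    intro f
    induction f using lead_induction with
    | zero => exact ⟨0, by simp⟩
    | step f a b hf ih =>
    have of_mem : (∃ g ∈ I, HasLead g a b) → ∃ v, f - underStaircase α v ∈ I := by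
      rintro ⟨g, hgI, hg⟩
      obtain ⟨c, hc⟩ := hf.isBelow_sub hg
      obtain ⟨v, hv⟩ := ih _ hc
      refine ⟨v, ?_⟩
      have := add_mem hv (I.mul_mem_left (C (C c)) hgI)
      convert this using 1
      ring
    by_cases hb : b < n
    · by_cases ha : a < α ⟨b, hb⟩
      · obtain ⟨c, hc⟩ := hf.isBelow_sub (hasLead_monomial a b)
        obtain ⟨v, hv⟩ := ih _ hc
        refine ⟨v + Pi.single ⟨⟨b, hb⟩, ⟨a, ha⟩⟩ c, ?_⟩
        convert hv using 1
        rw [map_add, underStaircase, Fintype.linearCombination_apply_single, C_mul_monomial,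
          smul_monomial, C_mul', ← sub_sub, sub_right_comm]
      · refine of_mem ⟨C (X ^ (a - α ⟨b, hb⟩)) * (X ^ 0 * h ⟨b, hb⟩),
          I.mul_mem_left _ (I.mul_mem_left _ (hmem _)), ?_⟩
        simpa [Nat.add_sub_of_le (not_lt.1 ha)] using (hlead ⟨b, hb⟩).shift (a - α ⟨b, hb⟩) 0
    · refine of_mem ⟨C (X ^ a) * (X ^ (b - r₀) * h r₀),
        I.mul_mem_left _ (I.mul_mem_left _ (hmem _)), ?_⟩
      have := (hlead r₀).shift a (b - r₀)
      rwa [hr₀, zero_add, Nat.add_sub_of_le (r₀.2.le.trans (not_lt.1 hb))] at this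
  have bij : Function.Bijective φ := by
    refine ⟨inj, fun q => ?_⟩
    obtain ⟨f, rfl⟩ := Ideal.Quotient.mk_surjective q
    obtain ⟨v, hv⟩ := surj f
    exact ⟨v, (Ideal.Quotient.eq.2 hv).symm⟩
  rw [← (LinearEquiv.ofBijective φ bij).finrank_eq, Module.finrank_fintype_fun_eq_card]
  simp

end Division
-- Shifted leading matrix and degree of the determinant
section LeadingMatrix

theorem natDegree_prod_le_and_coeff {R ι : Type*} [CommSemiring R] (s : Finset ι) (f : ι → R[X])
    (t : ι → ℕ) (h : ∀ i ∈ s, (f i).natDegree ≤ t i) :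
    (∏ i ∈ s, f i).natDegree ≤ ∑ i ∈ s, t i ∧
      (∏ i ∈ s, f i).coeff (∑ i ∈ s, t i) = ∏ i ∈ s, (f i).coeff (t i) := by
  classical
  induction s using Finset.induction_on with
  | empty => simp
  | insert a s ha ih =>
    obtain ⟨h1, h2⟩ := ih fun i hi => h i (Finset.mem_insert_of_mem hi)
    have h3 := h a (Finset.mem_insert_self a s)
    simp only [Finset.prod_insert ha, Finset.sum_insert ha]
    exact ⟨natDegree_mul_le_of_le h3 h1, by rw [coeff_mul_add_eq_of_natDegree_le h3 h1, h2]⟩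

/-- If the degrees of the entries of the `i`-th row are at most `t i`, the coefficient of degree
`∑ i, t i` of the determinant is the determinant of the coefficients of degree `t i`. -/
theorem natDegree_det_le_and_coeff {R m : Type*} [CommRing R] [Fintype m] [DecidableEq m]
    (N : Matrix m m R[X]) (t : m → ℕ) (h : ∀ i j, (N i j).natDegree ≤ t i) :
    N.det.natDegree ≤ ∑ i, t i ∧
      N.det.coeff (∑ i, t i) = (Matrix.of fun i j => (N i j).coeff (t i)).det := by
  have key (σ : Equiv.Perm m) := natDegree_prod_le_and_coeff Finset.univ
    (fun i => N (σ i) i) (fun i => t (σ i)) fun i _ => h _ _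
  simp only [fun σ : Equiv.Perm m => Equiv.sum_comp σ t] at key
  rw [Matrix.det_apply, Matrix.det_apply, finsetSum_coeff]
  refine ⟨natDegree_sum_le_of_forall_le _ _ fun σ _ => ?_, Finset.sum_congr rfl fun σ _ => ?_⟩
  · exact (natDegree_smul_le _ _).trans (key σ).1
  · rw [Units.smul_def, Units.smul_def, coeff_smul, (key σ).2]
    rfl

variable {K : Type*} [Field K] {n : ℕ} {M : Matrix (Fin n) (Fin n) K[X]} {h : Fin n → K[X][Y]}
  {α : Fin n → ℕ}

/-- With shift `j` on column `j`, a term `x ^ d` of an entry counts as the total degree of `x ^ d *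
y ^ j`, which the leading monomial maximizes. -/
theorem shiftedRowDegree_eq (hM : ∀ i j, M i j = (h i).coeff j)
    (hlead : ∀ r, HasLead (h r) (α r) r) (i : Fin n) :
    shiftedRowDegree (fun j => ((j : ℕ) : ℤ)) M i = ((α i + i : ℤ) : WithBot ℤ) := by
  have bound (d : ℕ) (j : Fin n) :
      ((d : WithBot ℕ).map fun d : ℕ => (d : ℤ)) + (((j : ℕ) : ℤ) : WithBot ℤ)
        = ((d + j : ℤ) : WithBot ℤ) := rfl
  apply le_antisymm
  · refine Finset.sup_le fun j _ => ?_
    by_cases h0 : M i j = 0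
    · simp [h0]
    · rw [degree_eq_natDegree h0, bound, WithBot.coe_le_coe]
      have := (hlead i).2 (M i j).natDegree j (by
        rw [← hM, coeff_natDegree]
        exact leadingCoeff_ne_zero.2 h0)
      omega
  · refine le_trans ?_ (Finset.le_sup (Finset.mem_univ i))
    have hc := (hlead i).1
    rw [← hM] at hc
    have h0 : M i i ≠ 0 := fun h0 => hc (by simp [h0])
    rw [degree_eq_natDegree h0, bound, WithBot.coe_le_coe]
    have := le_natDegree_of_ne_zero hc
    omega

theorem shiftedLeadingMatrix_apply (hM : ∀ i j, M i j = (h i).coeff j)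
    (hlead : ∀ r, HasLead (h r) (α r) r) (i j : Fin n) :
    shiftedLeadingMatrix (fun j => ((j : ℕ) : ℤ)) M i j =
      if (j : ℕ) ≤ α i + i then (M i j).coeff (α i + i - j) else 0 := by
  rw [shiftedLeadingMatrix, Matrix.of_apply, shiftedRowDegree_eq hM hlead, WithBot.recBotCoe_coe]
  have h1 : (α i + i - j : ℤ).toNat = α i + i - j := by omega
  rw [h1]
  exact if_congr (by omega) rfl rfl

theorem shiftedLeadingMatrix_diag (hM : ∀ i j, M i j = (h i).coeff j)
    (hlead : ∀ r, HasLead (h r) (α r) r) (i : Fin n) :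
    shiftedLeadingMatrix (fun j => ((j : ℕ) : ℤ)) M i i ≠ 0 := by
  rw [shiftedLeadingMatrix_apply hM hlead, if_pos (by omega), Nat.add_sub_cancel, hM]
  exact (hlead i).1

/-- A nonzero entry right of the diagonal would be a monomial of top total degree with a larger
exponent of `y` than the leading one. -/
theorem shiftedLeadingMatrix_isLowerTriangular (hM : ∀ i j, M i j = (h i).coeff j)
    (hlead : ∀ r, HasLead (h r) (α r) r) :
    (shiftedLeadingMatrix (fun j => ((j : ℕ) : ℤ)) M).IsLowerTriangular := by
  intro i j hij
  replace hij : (i : ℕ) < j := hij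
  rw [shiftedLeadingMatrix_apply hM hlead]
  split_ifs with hj
  · by_contra hc
    rw [hM] at hc
    have := (hlead i).2 _ _ hc
    omega
  · rfl

theorem det_shiftedLeadingMatrix_ne_zero (hM : ∀ i j, M i j = (h i).coeff j)
    (hlead : ∀ r, HasLead (h r) (α r) r) :
    (shiftedLeadingMatrix (fun j => ((j : ℕ) : ℤ)) M).det ≠ 0 := by
  rw [Matrix.det_of_isLowerTriangular _ (shiftedLeadingMatrix_isLowerTriangular hM hlead)]
  exact Finset.prod_ne_zero_iff.2 fun i _ => shiftedLeadingMatrix_diag hM hlead i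

theorem isShiftedWeakPopov_of_hasLead (hM : ∀ i j, M i j = (h i).coeff j)
    (hlead : ∀ r, HasLead (h r) (α r) r) :
    IsShiftedWeakPopov (fun j => ((j : ℕ) : ℤ)) M :=
  ⟨(Matrix.isUnit_iff_isUnit_det _).2 (det_shiftedLeadingMatrix_ne_zero hM hlead).isUnit,
    shiftedLeadingMatrix_isLowerTriangular hM hlead⟩

theorem degree_det_of_hasLead (hM : ∀ i j, M i j = (h i).coeff j)
    (hlead : ∀ r, HasLead (h r) (α r) r) : M.det.degree = ((∑ i, α i : ℕ) : WithBot ℕ) := by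
  -- Scaling column `j` by `x ^ j` turns shifted row degrees into ordinary ones and adds `∑ j` to
  -- the degree of the determinant.
  let N : Matrix (Fin n) (Fin n) K[X] := Matrix.of fun i j => X ^ (j : ℕ) * M i j
  have hN : N.det = X ^ (∑ j : Fin n, (j : ℕ)) * M.det := by
    rw [Matrix.det_mul_row, Finset.prod_pow_eq_pow_sum]
  have hL : (Matrix.of fun i j => (N i j).coeff (α i + i)) =
      shiftedLeadingMatrix (fun j => ((j : ℕ) : ℤ)) M := by
    ext i j
    rw [shiftedLeadingMatrix_apply hM hlead]
    simp [N, coeff_X_pow_mul']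
  obtain ⟨h1, h2⟩ := natDegree_det_le_and_coeff N (fun i => α i + i) fun i j => by
    refine natDegree_le_iff_coeff_eq_zero.2 fun d hd => ?_
    change (X ^ (j : ℕ) * M i j).coeff d = 0
    rw [coeff_X_pow_mul']
    split_ifs with hj
    · by_contra hc
      rw [hM] at hc
      have := (hlead i).2 _ _ hc
      omega
    · rfl
  have h3 : N.det.coeff (∑ i, (α i + i)) ≠ 0 := by
    rw [h2, hL]
    exact det_shiftedLeadingMatrix_ne_zero hM hlead
  have h4 : N.det.natDegree = ∑ i, (α i + i) := natDegree_eq_of_le_of_coeff_ne_zero h1 h3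
  have h0 : M.det ≠ 0 := by
    intro h0
    simp [hN, h0] at h3
  rw [hN, natDegree_mul (pow_ne_zero _ X_ne_zero) h0, natDegree_X_pow, Finset.sum_add_distrib]
    at h4
  rw [degree_eq_natDegree h0]
  congr 1
  omega

end LeadingMatrix
-- Consequences of minimality and of finite dimension
section Groebner

variable {K : Type*} [Field K]

/-- Leading coefficients are units, so the ideal is monomial and membership is divisibility by a
generator. -/
theorem leadingTerm_mem_span_iff {σ ι : Type*} (m : MonomialOrder σ) {s : Set ι}
    {g : ι → MvPolynomial σ K} (hg : ∀ i ∈ s, g i ≠ 0) {f : MvPolynomial σ K} (hf : f ≠ 0) :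
    m.leadingTerm f ∈ Ideal.span ((fun i => m.leadingTerm (g i)) '' s) ↔
      ∃ i ∈ s, m.degree (g i) ≤ m.degree f := by
  have hspan : Ideal.span ((fun i => m.leadingTerm (g i)) '' s) =
      Ideal.span ((fun e => MvPolynomial.monomial e (1 : K)) '' ((fun i => m.degree (g i)) '' s)) := by
    rw [Set.image_image]
    apply le_antisymm <;> rw [Ideal.span_le] <;> rintro _ ⟨i, hi, rfl⟩
    · refine Ideal.mem_of_dvd _ ?_ (Ideal.subset_span ⟨i, hi, rfl⟩)
      exact MvPolynomial.monomial_dvd_monomial.2 ⟨Or.inr le_rfl, one_dvd _⟩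
    · refine Ideal.mem_of_dvd _ ?_ (Ideal.subset_span ⟨i, hi, rfl⟩)
      exact MvPolynomial.monomial_dvd_monomial.2 ⟨Or.inr le_rfl,
        (IsUnit.mk0 _ (m.leadingCoeff_ne_zero_iff.2 (hg i hi))).dvd⟩
  rw [hspan, MvPolynomial.mem_ideal_span_monomial_image, m.support_leadingTerm' hf]
  simp

variable {ι : Type*} [Finite ι] {I : Ideal K[X][Y]} {g : ι → K[X][Y]}

theorem IsMinimalDrlBasis.mem (hg : IsMinimalDrlBasis I g) (i : ι) : g i ∈ I := by
  have := hg.1.1 i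
  rw [Ideal.mem_map_of_equiv] at this
  obtain ⟨x, hx, h⟩ := this
  rwa [← (Bivariate.equivMvPolynomial K).injective h]

theorem IsMinimalDrlBasis.ne_zero (hg : IsMinimalDrlBasis I g) (i : ι) : g i ≠ 0 := by
  intro h
  refine hg.2 i ?_
  -- A zero element would have leading term `0`, which lies in every ideal.
  simp [h]

theorem IsMinimalDrlBasis.hasLead (hg : IsMinimalDrlBasis I g) (i : ι) :
    HasLead (g i) (lmExp (g i) 0) (lmExp (g i) 1) :=
  hasLead_lmExp (hg.ne_zero i)

theorem IsMinimalDrlBasis.not_le (hg : IsMinimalDrlBasis I g) {i j : ι} (hij : i ≠ j) :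
    ¬ (lmExp (g i) 0 ≤ lmExp (g j) 0 ∧ lmExp (g i) 1 ≤ lmExp (g j) 1) := by
  intro h
  refine hg.2 j ?_
  rw [leadingTerm_mem_span_iff drl (fun k _ => by simpa using hg.ne_zero k)
    (by simpa using hg.ne_zero j)]
  exact ⟨i, hij, fun k => by fin_cases k; exacts [h.1, h.2]⟩

theorem IsMinimalDrlBasis.exists_le (hg : IsMinimalDrlBasis I g) {f : K[X][Y]} (hf : f ∈ I)
    {a b : ℕ} (hl : HasLead f a b) : ∃ i, lmExp (g i) 0 ≤ a ∧ lmExp (g i) 1 ≤ b := by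
  have hmem : drl.leadingTerm (Bivariate.equivMvPolynomial K f) ∈
      Ideal.span (Set.range fun i => drl.leadingTerm (Bivariate.equivMvPolynomial K (g i))) := by
    rw [hg.1.2]
    exact Ideal.subset_span ⟨_, Ideal.mem_map_of_mem _ hf, rfl⟩
  rw [← Set.image_univ, leadingTerm_mem_span_iff drl (fun k _ => by simpa using hg.ne_zero k)
    (by simpa using hl.ne_zero)] at hmem
  obtain ⟨i, -, hi⟩ := hmem
  obtain ⟨rfl, rfl⟩ := hl.unique (hasLead_lmExp hl.ne_zero)
  exact ⟨i, hi 0, hi 1⟩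

/-- The class of `z` in the quotient is integral over `K`; its minimal polynomial works. -/
theorem exists_aeval_mem [Module.Finite K (K[X][Y] ⧸ I)] (z : K[X][Y]) :
    ∃ q : K[X], q ≠ 0 ∧ aeval z q ∈ I := by
  have hz : IsIntegral K (Ideal.Quotient.mkₐ K I z) := Algebra.IsIntegral.isIntegral _
  refine ⟨minpoly K (Ideal.Quotient.mkₐ K I z), minpoly.ne_zero hz, ?_⟩
  rw [← Ideal.Quotient.eq_zero_iff_mem, ← Ideal.Quotient.mkₐ_eq_mk K, ← aeval_algHom_apply,
    minpoly.aeval]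

theorem exists_mem_hasLead_x [Module.Finite K (K[X][Y] ⧸ I)] : ∃ f ∈ I, ∃ a, HasLead f a 0 := by
  obtain ⟨q, q0, hq⟩ := exists_aeval_mem (I := I) (C X)
  have h : aeval (C X : K[X][Y]) q = C q := by
    have := aeval_algHom_apply (CAlgHom (R := K) (A := K[X])) X q
    simpa using this
  rw [h] at hq
  obtain ⟨a, b, hl⟩ := exists_hasLead (C_ne_zero.2 q0)
  obtain rfl : b = 0 := by
    by_contra hb
    exact hl.1 (by rw [coeff_C_of_ne_zero hb, coeff_zero])
  exact ⟨_, hq, a, hl⟩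

theorem exists_mem_hasLead_y [Module.Finite K (K[X][Y] ⧸ I)] : ∃ f ∈ I, ∃ b, HasLead f 0 b := by
  obtain ⟨q, q0, hq⟩ := exists_aeval_mem (I := I) X
  have h : aeval (X : K[X][Y]) q = q.map C := by
    rw [← eval₂_C_X (p := q.map C), eval₂_map]
    rfl
  rw [h] at hq
  obtain ⟨a, b, hl⟩ := exists_hasLead ((Polynomial.map_ne_zero_iff C_injective).2 q0)
  obtain rfl : a = 0 := by
    by_contra ha
    exact hl.1 (by rw [coeff_map, coeff_C_of_ne_zero ha])
  exact ⟨_, hq, b, hl⟩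

end Groebner

/-! ### Block positions and the staircase of the rows -/

section Blocks

variable {K : Type*} [Field K] {I : Ideal K[X][Y]} {l : ℕ} {g : Fin (l + 1) → K[X][Y]}

theorem IsMinimalDrlBasis.lmExp_zero_lt (hg : IsMinimalDrlBasis I g)
    (hsort : Monotone fun i => lmYDegree (g i)) {i j : Fin (l + 1)} (hij : i < j) :
    lmExp (g j) 0 < lmExp (g i) 0 := by
  by_contra! h
  exact hg.not_le hij.ne ⟨h, hsort hij.le⟩

theorem IsMinimalDrlBasis.lmYDegree_zero [Module.Finite K (K[X][Y] ⧸ I)]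
    (hg : IsMinimalDrlBasis I g) (hsort : Monotone fun i => lmYDegree (g i)) :
    lmYDegree (g 0) = 0 := by
  obtain ⟨f, hf, a, hl⟩ := exists_mem_hasLead_x (I := I)
  obtain ⟨i, -, hi⟩ := hg.exists_le hf hl
  exact Nat.eq_zero_of_le_zero ((hsort (Fin.zero_le i)).trans hi)

theorem IsMinimalDrlBasis.lmExp_last [Module.Finite K (K[X][Y] ⧸ I)]
    (hg : IsMinimalDrlBasis I g) (hsort : Monotone fun i => lmYDegree (g i)) :
    lmExp (g (Fin.last l)) 0 = 0 := by
  obtain ⟨f, hf, b, hl⟩ := exists_mem_hasLead_y (I := I)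
  obtain ⟨i, hi, -⟩ := hg.exists_le hf hl
  rcases (Fin.le_last i).eq_or_lt with rfl | h
  · omega
  · have := hg.lmExp_zero_lt hsort h
    omega

/-- The sum telescopes; monotonicity keeps the natural-number subtractions from truncating. -/
theorem sum_blockSize (h0 : lmYDegree (g 0) = 0) (hsort : Monotone fun i => lmYDegree (g i))
    (m : ℕ) (hm : m < l + 1) :
    ∑ j : Fin m, blockSize g (Fin.castLE hm.le j) = lmYDegree (g ⟨m, hm⟩) := by
  induction m with
  | zero => simpa using h0.symm
  | succ m ih =>
    rw [Fin.sum_univ_castSucc]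
    have h1 := ih (by omega)
    have h2 : blockSize g (Fin.castLE hm.le (Fin.last m)) =
        lmYDegree (g ⟨m + 1, hm⟩) - lmYDegree (g ⟨m, by omega⟩) :=
      Fin.snoc_castSucc (α := fun _ => ℕ) _ _ (⟨m, by omega⟩ : Fin l)
    have h3 : lmYDegree (g ⟨m, by omega⟩) ≤ lmYDegree (g ⟨m + 1, hm⟩) :=
      hsort (Fin.mk_le_mk.2 (Nat.le_succ m))
    rw [h2]
    refine (congrArg (· + _) h1).trans ?_
    omega

theorem rowIndex_val (h0 : lmYDegree (g 0) = 0) (hsort : Monotone fun i => lmYDegree (g i))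
    (s : Σ i : Fin (l + 1), Fin (blockSize g i)) :
    (rowIndex g s : ℕ) = lmYDegree (g s.1) + s.2 := by
  refine (finSigmaFinEquiv_apply s).trans ?_
  rw [sum_blockSize h0 hsort s.1 s.1.2]

theorem blockSize_last : blockSize g (Fin.last l) = lastBlockSize g :=
  Fin.snoc_last (α := fun _ => ℕ) _ _

theorem blockSize_castSucc (i : Fin l) : blockSize g i.castSucc = innerBlockSize g i :=
  Fin.snoc_castSucc (α := fun _ => ℕ) _ _ i

theorem matrixSize_eq (h0 : lmYDegree (g 0) = 0) (hsort : Monotone fun i => lmYDegree (g i)) :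
    matrixSize g = lmYDegree (g (Fin.last l)) + lastBlockSize g := by
  rw [matrixSize, Fin.sum_univ_castSucc, blockSize_last]
  congr 1
  exact sum_blockSize h0 hsort l (Nat.lt_succ_self l)

theorem HasLead.natDegree_le {f : K[X][Y]} {a b : ℕ} (h : HasLead f a b) :
    f.natDegree ≤ a + b := by
  have hne : f.coeff f.natDegree ≠ 0 := leadingCoeff_ne_zero.2 h.ne_zero
  have := h.2 _ f.natDegree (leadingCoeff_ne_zero.2 hne)
  omega

/-- For the last element, whose leading monomial is a pure power of `y`, the degree in `y` is at
most that of the leading monomial; for the others the bound is built into `lastBlockSize`. -/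
theorem natDegree_add_blockSize_le [Module.Finite K (K[X][Y] ⧸ I)]
    (hg : IsMinimalDrlBasis I g) (hsort : Monotone fun i => lmYDegree (g i)) (i : Fin (l + 1)) :
    (g i).natDegree + blockSize g i ≤ matrixSize g := by
  have hlast : (g (Fin.last l)).natDegree ≤ lmYDegree (g (Fin.last l)) := by
    have := (hg.hasLead (Fin.last l)).natDegree_le
    rwa [hg.lmExp_last hsort, zero_add] at this
  rw [matrixSize_eq (hg.lmYDegree_zero hsort) hsort]
  induction i using Fin.lastCases with
  | last => rw [blockSize_last]; omega
  | cast i =>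
    have := Finset.le_sup (f := fun i : Fin l => innerBlockSize g i + (g i.castSucc).natDegree)
      (Finset.mem_univ i)
    rw [blockSize_castSucc, lastBlockSize]
    omega

theorem shiftedFamily_mem [Module.Finite K (K[X][Y] ⧸ I)]
    (hg : IsMinimalDrlBasis I g) (hsort : Monotone fun i => lmYDegree (g i))
    (r : Fin (matrixSize g)) : shiftedFamily g r ∈ truncatedIdeal I (matrixSize g) := by
  refine ⟨I.mul_mem_left _ (hg.mem _), Polynomial.mem_degreeLT.2 ?_⟩
  have h1 := natDegree_add_blockSize_le hg hsort ((rowIndex g).symm r).1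
  have h2 := ((rowIndex g).symm r).2.2
  have h3 : (shiftedFamily g r).natDegree ≤ _ + _ :=
    natDegree_mul_le.trans (Nat.add_le_add_right (natDegree_X_pow_le _) _)
  refine degree_le_natDegree.trans_lt ?_
  exact_mod_cast (by omega : (shiftedFamily g r).natDegree < matrixSize g)

theorem shiftedFamily_hasLead [Module.Finite K (K[X][Y] ⧸ I)]
    (hg : IsMinimalDrlBasis I g) (hsort : Monotone fun i => lmYDegree (g i))
    (r : Fin (matrixSize g)) :
    HasLead (shiftedFamily g r) (lmExp (g ((rowIndex g).symm r).1) 0) r := by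
  have h := (hg.hasLead ((rowIndex g).symm r).1).shift 0 ((rowIndex g).symm r).2
  have hr := rowIndex_val (hg.lmYDegree_zero hsort) hsort ((rowIndex g).symm r)
  rw [Equiv.apply_symm_apply] at hr
  rw [hr]
  rwa [pow_zero, C_1, one_mul] at h

theorem lmExp_le_of_hasLead [Module.Finite K (K[X][Y] ⧸ I)]
    (hg : IsMinimalDrlBasis I g) (hsort : Monotone fun i => lmYDegree (g i))
    (f : K[X][Y]) (hf : f ∈ I) (a : ℕ) (b : Fin (matrixSize g)) (hl : HasLead f a b) :
    lmExp (g ((rowIndex g).symm b).1) 0 ≤ a := by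
  obtain ⟨j, hj0, hj1⟩ := hg.exists_le hf hl
  have hb := rowIndex_val (hg.lmYDegree_zero hsort) hsort ((rowIndex g).symm b)
  rw [Equiv.apply_symm_apply] at hb
  generalize (rowIndex g).symm b = s at hb
  obtain ⟨i, k⟩ := s
  dsimp only at hb ⊢
  rcases lt_trichotomy i j with h | rfl | h
  -- Row `b` lies in block `i`, so `b` is below the leading `y`-degree of the next element, hence
  -- below that of `g j`, against `hj1`.
  · exfalso
    induction i using Fin.lastCases with
    | last => exact absurd h (Fin.le_last j).not_gt
    | cast i =>
      have hk := k.2.trans_eq (blockSize_castSucc i)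
      rw [innerBlockSize] at hk
      have : lmYDegree (g i.succ) ≤ lmYDegree (g j) := hsort (Fin.castSucc_lt_iff_succ_le.1 h)
      change lmYDegree (g j) ≤ b at hj1
      omega
  · exact hj0
  · exact (hg.lmExp_zero_lt hsort h).le.trans hj0

theorem blockMatrix_apply (i j : Fin (matrixSize g)) :
    blockMatrix g i j = (shiftedFamily g i).coeff j := rfl

end Blocks

theorem mainTheorem5 {K : Type*} [Field K] (I : Ideal K[X][Y])
    (hI : Module.Finite K (K[X][Y] ⧸ I)) {l : ℕ} (g : Fin (l + 1) → K[X][Y])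
    (hg : IsMinimalDrlBasis I g) (hsort : Monotone fun i => lmYDegree (g i)) :
    -- the rows of the matrix represent elements of `I` of degree in `y` less than `n`
    (∀ r, shiftedFamily g r ∈ truncatedIdeal I (matrixSize g)) ∧
    -- the matrix is made of stacked Toeplitz blocks
    (∀ (i : Fin (l + 1)) (k : Fin (blockSize g i)) (c : Fin (matrixSize g)),
      blockMatrix g (rowIndex g ⟨i, k⟩) c =
        if (k : ℕ) ≤ (c : ℕ) then (g i).coeff ((c : ℕ) - (k : ℕ)) else 0) ∧
    IsShiftedWeakPopov (fun j => ((j : ℕ) : ℤ)) (blockMatrix g) ∧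
    (blockMatrix g).det.degree = (Module.finrank K (K[X][Y] ⧸ I) : WithBot ℕ) ∧
    IsBasisMatrix (blockMatrix g)
      ((truncatedIdeal I (matrixSize g)).map (yCoords K (matrixSize g))) := by
  have hmem := shiftedFamily_mem hg hsort
  have hlead := shiftedFamily_hasLead hg hsort
  have hdiv := lmExp_le_of_hasLead hg hsort
  have hdeg := degree_det_of_hasLead blockMatrix_apply hlead
  refine ⟨hmem, fun i k c => ?_, isShiftedWeakPopov_of_hasLead blockMatrix_apply hlead, ?_, ?_, ?_⟩
  · rw [blockMatrix_apply, shiftedFamily, Equiv.symm_apply_apply, coeff_X_pow_mul']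
  -- The `max 1` in the last block size guarantees a row led by a pure power of `y`.
  · have hpos : 0 < blockSize g (Fin.last l) := by
      rw [blockSize_last]
      exact lt_max_of_lt_left one_pos
    rw [hdeg, finrank_quotient_eq_sum (fun r => (hmem r).1) hlead hdiv
      (rowIndex g ⟨Fin.last l, ⟨0, hpos⟩⟩)]
    rw [Equiv.symm_apply_apply]
    exact hg.lmExp_last hsort
  · intro h0
    rw [h0, degree_zero] at hdeg
    exact WithBot.bot_ne_coe hdeg
  · have hspan : truncatedIdeal I (matrixSize g) =
        Submodule.span K[X] (Set.range (shiftedFamily g)) :=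
      le_antisymm (truncatedIdeal_le_span hmem hlead hdiv)
        (Submodule.span_le.2 (Set.range_subset_iff.2 hmem))
    rw [hspan, Submodule.map_span, ← Set.range_comp]
    rfl
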